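/- Theorem (boundary Harnack principle for the singular Lane-Emden-Fowler equation over a general Lipschitz graph). Let $n\ge 1$, $L\ge 0$, $\gamma>0$ and $0<\lambda\le\Lambda$. There is a constant $C=C(n,L,\gamma,\lambda,\Lambda)>0$ with the following property. Let $R>0$ and let $g:\mathbb{R}^{n-1}\to\mathbb{R}$ be a function with $g(0)=0$ and Lipschitz constant at most $L$. Write $X=(x',x_n)\in\mathbb{R}^{n-1}\times\mathbb{R}$, let $\Gamma=\{x_n=g(x')\}$, and for $r>0$ let $$\mathcal{GC}_r=\{X:\ |x'|\le r,\ 0\le x_n-g(x')\le r\},\qquad \mathcal{GC}_r^{\circ}=\{X:\ |x'|<r,\ 0<x_n-g(x')<r\}.$$ Let $f$ be a function with $\lambda\le f\le\Lambda$ in $\mathcal{GC}_{3R}^{\circ}$, and let $u$ and $v$ both be classical solutions of the singular equation in $\mathcal{GC}_{3R}$ vanishing on $\Gamma$ (with the same $f$); that is, each $w\in\{u,v\}$ is of class $C^2$ and positive in $\mathcal{GC}_{3R}^{\circ}$ and continuous on $\mathcal{GC}_{3R}^{\circ}\cup(\Gamma\cap\{|x'|<3R\})$, and satisfies $$-\Delta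 w=f\,w^{-\gamma}\ \text{ in }\mathcal{GC}_{3R}^{\circ},\qquad w=0\ \text{ on }\Gamma\cap\{|x'|<3R\}.$$ Then $$C^{-1}\,\frac{R^{\frac{2}{1+\gamma}}}{\|v\|_{L^\infty(\mathcal{GC}_{3R})}}\ \le\ \frac{u(X)}{v(X)}\ \le\ C\,\frac{\|u\|_{L^\infty(\mathcal{GC}_{3R})}}{R^{\frac{2}{1+\gamma}}}\qquad\text{for all }X\in\mathcal{GC}_R\setminus\Gamma .$$ (If $\|v\|_{L^\infty(\mathcal{GC}_{3R})}=\infty$ the left-hand side is read as $0$, and if $\|u\|_{L^\infty(\mathcal{GC}_{3R})}=\infty$ the right-hand side is read as $\infty$.) -/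

import Mathlib

open Set MeasureTheory
open scoped ENNReal NNReal

/-- The horizontal part `x'` (the first `d = n - 1` coordinates) of `X = (x', xₙ)` in `ℝⁿ`. -/
noncomputable def hpart {d : ℕ} (X : EuclideanSpace ℝ (Fin (d + 1))) : EuclideanSpace ℝ (Fin d) :=
  WithLp.toLp 2 (fun i : Fin d => X i.castSucc)

/-- The height `xₙ - g(x')` of `X = (x', xₙ)` over the graph of `g`. -/
noncomputable def heightOver {d : ℕ} (g : EuclideanSpace ℝ (Fin d) → ℝ)
    (X : EuclideanSpace ℝ (Fin (d + 1))) : ℝ :=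
  X (Fin.last d) - g (hpart X)

/-- The graph `Γ = {xₙ = g(x')}`. -/
def graphSet {d : ℕ} (g : EuclideanSpace ℝ (Fin d) → ℝ) : Set (EuclideanSpace ℝ (Fin (d + 1))) :=
  {X | heightOver g X = 0}

/-- The grounded cylinder `GC_r(X) = {Y : |x' - y'| ≤ r, 0 ≤ yₙ - g(y') ≤ r}`. -/
def groundedCylinder {d : ℕ} (g : EuclideanSpace ℝ (Fin d) → ℝ)
    (X : EuclideanSpace ℝ (Fin (d + 1))) (r : ℝ) : Set (EuclideanSpace ℝ (Fin (d + 1))) :=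
  {Y | ‖hpart X - hpart Y‖ ≤ r ∧ 0 ≤ heightOver g Y ∧ heightOver g Y ≤ r}

/-- The open version of the grounded cylinder; for continuous `g` and `r > 0` it is the interior of
`GC_r(X)`. -/
def openGroundedCylinder {d : ℕ} (g : EuclideanSpace ℝ (Fin d) → ℝ)
    (X : EuclideanSpace ℝ (Fin (d + 1))) (r : ℝ) : Set (EuclideanSpace ℝ (Fin (d + 1))) :=
  {Y | ‖hpart X - hpart Y‖ < r ∧ 0 < heightOver g Y ∧ heightOver g Y < r}

/-- The relatively open piece of the graph that lies at the bottom of `GC_r(X)`. -/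
def graphBase {d : ℕ} (g : EuclideanSpace ℝ (Fin d) → ℝ)
    (X : EuclideanSpace ℝ (Fin (d + 1))) (r : ℝ) : Set (EuclideanSpace ℝ (Fin (d + 1))) :=
  {Y | ‖hpart X - hpart Y‖ < r ∧ Y ∈ graphSet g}

/-- `u` is a classical solution of `-Δu = f u^{-γ}` in `GC_r(X)` vanishing on the graph of `g`:
it is positive, `C²` and solves the equation in the open cylinder, and it extends continuously, by
the value zero, to the graph. Nothing is required on the lateral and top parts of the boundary. -/
structure IsSingularSolution {d : ℕ} (g : EuclideanSpace ℝ (Fin d) → ℝ) (γ : ℝ)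
    (f : EuclideanSpace ℝ (Fin (d + 1)) → ℝ) (X : EuclideanSpace ℝ (Fin (d + 1))) (r : ℝ)
    (u : EuclideanSpace ℝ (Fin (d + 1)) → ℝ) : Prop where
  contDiffOn : ContDiffOn ℝ 2 u (openGroundedCylinder g X r)
  pos : ∀ Y ∈ openGroundedCylinder g X r, 0 < u Y
  equation : ∀ Y ∈ openGroundedCylinder g X r,
    -(Laplacian.laplacian u Y) = f Y * (u Y) ^ (-γ)
  continuousOn : ContinuousOn u (openGroundedCylinder g X r ∪ graphBase g X r)
  zero_on_graph : ∀ Y ∈ graphBase g X r, u Y = 0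

/-- The norm `‖u‖_{L^∞(A)}` with respect to Lebesgue measure, with values in `[0, ∞]`. -/
noncomputable def supNormOn {d : ℕ} (u : EuclideanSpace ℝ (Fin (d + 1)) → ℝ)
    (A : Set (EuclideanSpace ℝ (Fin (d + 1)))) : ℝ≥0∞ :=
  eLpNorm u ∞ (volume.restrict A)

/-!
The upper bound for `u / v` suffices: the lower bound is the upper bound for `v / u`, inverted.

The equation enters in two ways only. First, it is nondegenerate: comparison with a paraboloid gives
`w ≥ c R ^ (2 / (1 + γ))` for each solution `w` at points whose distance from the graph is
comparable to `R` (`IsSingularSolution.le_center`). Second, since `t ↦ t ^ (-γ)` is decreasing,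
`(u - v)⁺` is subharmonic, whereas `v` is superharmonic; so `w = K v - (u - v)⁺` is superharmonic in
the viscosity sense for every `K ≥ 0`
(`IsSingularSolution.isViscositySuperharmonicOn`). With `U = ‖u‖` and `K` a large multiple of
`U / R ^ (2 / (1 + γ))`, the function `w` vanishes on the graph, is at least `-U` everywhere and is
at least a large multiple of `U` away from the graph. It remains to see that `w > 0` in the smaller
cylinder, for then `u ≤ (K + 1) v`, and `1` is absorbed because nondegeneracy of `u` bounds
`U / R ^ (2 / (1 + γ))` from below.

This is a statement about superharmonic functions over a Lipschitz graph (`exists_pos_on_axis`),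
proved by an iteration in the spirit of De Silva and Savin. Suppose that `w ≥ -t` in a cylinder of
size `r` and `w ≥ M t` on the part of it of height at least `δ r`. In the cylinder shrunk by a fixed
factor `θ < 1`, the bound on the upper part persists with a loss `a` that does not depend on `δ`
(`lower_bound_above`), while the negative part of `w`, confined to a layer of thickness `δ r`, decays
exponentially in the distance to the lateral boundary divided by `δ r` (`lower_bound_layer`), so
that for small `δ` it becomes at most `a t`. The same hypotheses thus hold with `θ r` and `a t` in
place of `r` and `t`, and iterating them gives `w > 0` on the whole axis of the cylinder. Both
estimates are a comparison with a Gaussian in an annulus (`exists_isDecayConstant`); in the second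
one the annulus is centered below the graph.
-/

/-! ### Second-derivative test and the Laplacian along coordinate lines -/

section Laplacian

open Laplacian Topology Filter

/-- Necessary second-order condition. No differentiability is assumed: where a derivative does not
exist, its default value `0` satisfies the inequality. -/
lemma deriv_deriv_nonneg_of_isLocalMin {h : ℝ → ℝ} {x : ℝ} (hmin : IsLocalMin h x)
    (hc : ContinuousAt h x) : 0 ≤ deriv (deriv h) x := by
  by_contra! hneg
  -- A negative second derivative would make `x` a local maximum too, hence `h` locally constant.
  have hmax := isLocalMax_of_deriv_deriv_neg hneg hmin.deriv_eq_zero hc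
  have heq : h =ᶠ[𝓝 x] fun _ => h x := by
    filter_upwards [hmin, hmax] with y h1 h2 using le_antisymm h2 h1
  have : deriv (deriv h) x = 0 := by
    rw [heq.deriv.deriv_eq]
    simp
  linarith

variable {E : Type*} [NormedAddCommGroup E] [InnerProductSpace ℝ E]

lemma iteratedFDeriv_two_eq_deriv_deriv {F : E → ℝ} {x : E} (hF : ContDiffAt ℝ 2 F x) (v : E) :
    iteratedFDeriv ℝ 2 F x ![v, v] = deriv (deriv fun t : ℝ => F (x + t • v)) 0 := by
  have hline : ∀ t : ℝ, HasDerivAt (fun t : ℝ => x + t • v) v t := fun t => by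
    simpa using ((hasDerivAt_id t).smul_const v).const_add x
  have htend : Tendsto (fun t : ℝ => x + t • v) (𝓝 0) (𝓝 x) := by
    have := (hline 0).continuousAt.tendsto
    simpa using this
  have h1 : (deriv fun t : ℝ => F (x + t • v)) =ᶠ[𝓝 0] fun t => fderiv ℝ F (x + t • v) v := by
    filter_upwards [htend.eventually (hF.eventually (by simp))] with t ht
    exact ((ht.differentiableAt (by simp)).hasFDerivAt.comp_hasDerivAt t (hline t)).deriv
  have h2 : HasFDerivAt (fderiv ℝ F) (fderiv ℝ (fderiv ℝ F) x) (x + (0 : ℝ) • v) := by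
    have : ContDiffAt ℝ 1 (fderiv ℝ F) x := hF.fderiv_right (by norm_num)
    simpa using (this.differentiableAt (by simp)).hasFDerivAt
  have h3 : HasDerivAt (fun t : ℝ => fderiv ℝ F (x + t • v)) (fderiv ℝ (fderiv ℝ F) x v) 0 :=
    h2.comp_hasDerivAt (0 : ℝ) (hline 0)
  have h4 : HasDerivAt (fun t : ℝ => fderiv ℝ F (x + t • v) v) (fderiv ℝ (fderiv ℝ F) x v v) 0 :=
    (ContinuousLinearMap.apply ℝ ℝ v).hasFDerivAt.comp_hasDerivAt (0 : ℝ) h3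
  rw [h1.deriv_eq, iteratedFDeriv_two_apply, h4.deriv]
  rfl

lemma norm_add_smul_sq {y e : E} (he : ‖e‖ = 1) (t : ℝ) :
    ‖y + t • e‖ ^ 2 = ‖y‖ ^ 2 + 2 * t * inner ℝ y e + t ^ 2 := by
  rw [norm_add_sq_real, inner_smul_right, norm_smul, he]
  simp
  ring

lemma hasDerivAt_quadratic (a b p t : ℝ) :
    HasDerivAt (fun t : ℝ => a * (b + 2 * t * p + t ^ 2)) (a * (2 * p + 2 * t)) t := by
  have h1 := (((hasDerivAt_id' t).const_mul 2).mul_const p).const_add b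
  have h2 := (h1.fun_add (hasDerivAt_pow 2 t)).const_mul a
  exact h2.congr_deriv (by push_cast; ring)

lemma hasDerivAt_linear (a p t : ℝ) :
    HasDerivAt (fun t : ℝ => a * (2 * p + 2 * t)) (a * 2) t :=
  ((((hasDerivAt_id' t).const_mul 2).const_add (2 * p)).const_mul a).congr_deriv (by ring)

variable [FiniteDimensional ℝ E]

lemma laplacian_eq_sum_deriv_deriv {F : E → ℝ} {x : E} (hF : ContDiffAt ℝ 2 F x) :
    Δ F x = ∑ i, deriv (deriv fun t : ℝ => F (x + t • stdOrthonormalBasis ℝ E i)) 0 := by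
  rw [InnerProductSpace.laplacian_eq_iteratedFDeriv_stdOrthonormalBasis]
  exact Finset.sum_congr rfl fun i _ => iteratedFDeriv_two_eq_deriv_deriv hF _

lemma laplacian_le_of_isLocalMin_sub {w φ : E → ℝ} {x : E} (hw : ContDiffAt ℝ 2 w x)
    (hφ : ContDiffAt ℝ 2 φ x) (hmin : IsLocalMin (w - φ) x) : Δ φ x ≤ Δ w x := by
  have hd : ContDiffAt ℝ 2 (w - φ) x := hw.sub hφ
  have h0 : 0 ≤ Δ (w - φ) x := by
    rw [laplacian_eq_sum_deriv_deriv hd]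
    refine Finset.sum_nonneg fun i _ => ?_
    have hl : ContinuousAt (fun t : ℝ => x + t • stdOrthonormalBasis ℝ E i) 0 := by fun_prop
    have h0 : x + (0 : ℝ) • stdOrthonormalBasis ℝ E i = x := by simp
    refine deriv_deriv_nonneg_of_isLocalMin
      (IsMinFilter.comp_tendsto (f := w - φ) (l := 𝓝 x) ?_ ?_)
      (ContinuousAt.comp (g := w - φ) ?_ hl)
    · rwa [h0]
    · simpa only [ContinuousAt, h0] using hl
    · rw [h0]
      exact hd.continuousAt
  rw [hw.laplacian_sub hφ] at h0
  linarith

lemma laplacian_gaussian (A β c : ℝ) (Z x : E) :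
    Δ (fun Y : E => c + A * Real.exp (-β * ‖Y - Z‖ ^ 2)) x =
      A * Real.exp (-β * ‖x - Z‖ ^ 2) *
        (4 * β ^ 2 * ‖x - Z‖ ^ 2 - 2 * β * Module.finrank ℝ E) := by
  have hC : ContDiffAt ℝ 2 (fun Y : E => c + A * Real.exp (-β * ‖Y - Z‖ ^ 2)) x := by
    have : ContDiff ℝ 2 (fun Y : E => ‖Y - Z‖ ^ 2) := (contDiff_id.sub contDiff_const).norm_sq ℝ
    exact (contDiff_const.add (contDiff_const.mul
      (Real.contDiff_exp.comp (contDiff_const.mul this)))).contDiffAt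
  rw [laplacian_eq_sum_deriv_deriv hC]
  have key : ∀ i, deriv (deriv fun t : ℝ => c + A * Real.exp
      (-β * ‖x + t • stdOrthonormalBasis ℝ E i - Z‖ ^ 2)) 0 =
      A * Real.exp (-β * ‖x - Z‖ ^ 2) *
        (4 * β ^ 2 * inner ℝ (x - Z) (stdOrthonormalBasis ℝ E i) ^ 2 - 2 * β) := by
    intro i
    set p := inner ℝ (x - Z) (stdOrthonormalBasis ℝ E i)
    have hfun : (fun t : ℝ => c + A * Real.exp (-β * ‖x + t • stdOrthonormalBasis ℝ E i - Z‖ ^ 2)) =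
        fun t : ℝ => c + A * Real.exp (-β * (‖x - Z‖ ^ 2 + 2 * t * p + t ^ 2)) := by
      funext t
      rw [add_sub_right_comm, norm_add_smul_sq (by simp)]
    have hd : (deriv fun t : ℝ => c + A * Real.exp (-β * (‖x - Z‖ ^ 2 + 2 * t * p + t ^ 2))) =
        fun t => A * (Real.exp (-β * (‖x - Z‖ ^ 2 + 2 * t * p + t ^ 2)) * (-β * (2 * p + 2 * t))) :=
      funext fun t => (((hasDerivAt_quadratic (-β) _ p t).exp.const_mul A).const_add c).deriv
    rw [hfun, hd]
    rw [(((hasDerivAt_quadratic (-β) _ p 0).exp.fun_mul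
      (hasDerivAt_linear (-β) p 0)).const_mul A).deriv]
    simp only [mul_zero, zero_mul, add_zero, ne_eq, OfNat.ofNat_ne_zero, not_false_eq_true, zero_pow]
    ring
  rw [Finset.sum_congr rfl fun i _ => key i, ← Finset.mul_sum, Finset.sum_sub_distrib,
    ← Finset.mul_sum, OrthonormalBasis.sum_sq_inner_left]
  simp only [Finset.sum_const, Finset.card_univ, Fintype.card_fin, nsmul_eq_mul]
  ring

lemma laplacian_paraboloid (c k : ℝ) (Z x : E) :
    Δ (fun Y : E => c - k * ‖Y - Z‖ ^ 2) x = -(2 * k * Module.finrank ℝ E) := by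
  have hC : ContDiffAt ℝ 2 (fun Y : E => c - k * ‖Y - Z‖ ^ 2) x := by
    have : ContDiff ℝ 2 (fun Y : E => ‖Y - Z‖ ^ 2) := (contDiff_id.sub contDiff_const).norm_sq ℝ
    exact (contDiff_const.sub (contDiff_const.mul this)).contDiffAt
  rw [laplacian_eq_sum_deriv_deriv hC]
  have key : ∀ i, deriv (deriv fun t : ℝ => c - k *
      ‖x + t • stdOrthonormalBasis ℝ E i - Z‖ ^ 2) 0 = -(2 * k) := by
    intro i
    set p := inner ℝ (x - Z) (stdOrthonormalBasis ℝ E i)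
    have hfun : (fun t : ℝ => c - k * ‖x + t • stdOrthonormalBasis ℝ E i - Z‖ ^ 2) =
        fun t : ℝ => c - k * (‖x - Z‖ ^ 2 + 2 * t * p + t ^ 2) := by
      funext t
      rw [add_sub_right_comm, norm_add_smul_sq (by simp)]
    have hd : (deriv fun t : ℝ => c - k * (‖x - Z‖ ^ 2 + 2 * t * p + t ^ 2)) =
        fun t => -(k * (2 * p + 2 * t)) :=
      funext fun t => ((hasDerivAt_quadratic k _ p t).const_sub c).deriv
    rw [hfun, hd, (hasDerivAt_linear k p 0).fun_neg.deriv]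
    ring
  rw [Finset.sum_congr rfl fun i _ => key i]
  simp only [Finset.sum_const, Finset.card_univ, Fintype.card_fin, nsmul_eq_mul]
  ring

end Laplacian

/-! ### Viscosity superharmonic functions and the Gaussian barrier -/

section Viscosity

open Laplacian Topology Filter

variable {E : Type*} [NormedAddCommGroup E] [InnerProductSpace ℝ E] [FiniteDimensional ℝ E]

/-- `w` is superharmonic in `Ω` in the viscosity sense: a `C²` function touching `w` from below at a
point of `Ω` has nonpositive Laplacian there. Lower semicontinuity is not part of the definition;
continuity is assumed separately where it is needed. For open `Ω` this is a local condition. -/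
def IsViscositySuperharmonicOn (w : E → ℝ) (Ω : Set E) : Prop :=
  ∀ x ∈ Ω, ∀ φ : E → ℝ, ContDiffAt ℝ 2 φ x → IsLocalMin (w - φ) x → Δ φ x ≤ 0

lemma IsViscositySuperharmonicOn.mono {w : E → ℝ} {Ω Ω' : Set E}
    (hw : IsViscositySuperharmonicOn w Ω) (h : Ω' ⊆ Ω) : IsViscositySuperharmonicOn w Ω' :=
  fun x hx => hw x (h hx)

/-- Comparison from below with the Gaussian `c + A exp (-β |Y - Z|²)`, which is strictly
subharmonic outside the ball of radius `ρ` about `Z` as soon as `2 β ρ²` exceeds the dimension. -/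
lemma IsViscositySuperharmonicOn.gaussian_le {w : E → ℝ} {Ω K : Set E}
    (hw : IsViscositySuperharmonicOn w Ω) (hK : IsCompact K) (hc : ContinuousOn w K)
    {A β c ρ : ℝ} {Z : E} (hA : 0 < A) (hβ : 0 < β) (hρ : 0 < ρ)
    (hβρ : Module.finrank ℝ E < 2 * β * ρ ^ 2)
    (h : ∀ Y ∈ K, c + A * Real.exp (-β * ‖Y - Z‖ ^ 2) ≤ w Y ∨
      (Y ∈ Ω ∧ K ∈ 𝓝 Y ∧ ρ ≤ ‖Y - Z‖)) :
    ∀ Y ∈ K, c + A * Real.exp (-β * ‖Y - Z‖ ^ 2) ≤ w Y := by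
  set φ : E → ℝ := fun Y => c + A * Real.exp (-β * ‖Y - Z‖ ^ 2) with hφ
  have hφC : ContDiff ℝ 2 φ := by
    have : ContDiff ℝ 2 (fun Y : E => ‖Y - Z‖ ^ 2) := (contDiff_id.sub contDiff_const).norm_sq ℝ
    exact contDiff_const.add (contDiff_const.mul (Real.contDiff_exp.comp (contDiff_const.mul this)))
  intro Y hY
  obtain ⟨x, hxK, hx⟩ := hK.exists_isMinOn ⟨Y, hY⟩ (hc.sub hφC.continuous.continuousOn)
  have hxY : w x - φ x ≤ w Y - φ Y := hx hY
  rcases h x hxK with h1 | ⟨hxΩ, hKx, hxρ⟩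
  · have : φ x ≤ w x := h1
    change φ Y ≤ w Y
    linarith
  · have hmin : IsLocalMin (w - φ) x := hx.isLocalMin hKx
    have hle := hw x hxΩ φ hφC.contDiffAt hmin
    rw [hφ, laplacian_gaussian] at hle
    have hsq : ρ ^ 2 ≤ ‖x - Z‖ ^ 2 := by gcongr
    have hpos : 0 < 4 * β ^ 2 * ‖x - Z‖ ^ 2 - 2 * β * Module.finrank ℝ E := by
      have : 2 * β * ρ ^ 2 ≤ 2 * β * ‖x - Z‖ ^ 2 := by gcongr
      nlinarith
    have := mul_pos (mul_pos hA (Real.exp_pos (-β * ‖x - Z‖ ^ 2))) hpos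
    linarith

/-- `q` is a decay constant for the ratios `1 < s < b`: a superharmonic function that is at least
`m₁` on the part of the boundary of `K` nearest to `Z` and at least `m₀` at distance `b ρ` from `Z`
keeps the fraction `1 - q` of the gain `m₁ - m₀` up to distance `s ρ`. The set `K` avoids the open
ball of radius `ρ` about `Z`; all radii scale with `ρ`, so that `q` is scale invariant. -/
def IsDecayConstant (E : Type*) [NormedAddCommGroup E] [InnerProductSpace ℝ E]
    [FiniteDimensional ℝ E] (s b q : ℝ) : Prop :=
  ∀ (w : E → ℝ) (Ω K : Set E) (Z : E) (ρ m₀ m₁ : ℝ), IsViscositySuperharmonicOn w Ω →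
    IsCompact K → ContinuousOn w K → 0 < ρ → m₀ < m₁ →
    (∀ Y ∈ K, ρ ≤ ‖Y - Z‖) →
    (∀ Y ∈ K, m₁ ≤ w Y ∨ (m₀ ≤ w Y ∧ b * ρ ≤ ‖Y - Z‖) ∨ (Y ∈ Ω ∧ K ∈ 𝓝 Y)) →
    ∀ Y ∈ K, ‖Y - Z‖ ≤ s * ρ → m₁ - q * (m₁ - m₀) ≤ w Y

lemma exists_isDecayConstant [Nontrivial E] {s b : ℝ} (hs : 1 < s) (hsb : s < b) :
    ∃ q, 0 < q ∧ q < 1 ∧ IsDecayConstant E s b q := by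
  set n : ℝ := (Module.finrank ℝ E : ℝ)
  have hn : 0 < n := Nat.cast_pos.2 (Module.finrank_pos (R := ℝ) (M := E))
  have e1s : Real.exp (-n * s ^ 2) < Real.exp (-n) := by
    apply Real.exp_lt_exp.2
    have : 1 < s ^ 2 := by nlinarith
    nlinarith
  have esb : Real.exp (-n * b ^ 2) < Real.exp (-n * s ^ 2) := by
    apply Real.exp_lt_exp.2
    have : s ^ 2 < b ^ 2 := by nlinarith
    nlinarith
  set e₁ := Real.exp (-n)
  set eₛ := Real.exp (-n * s ^ 2)
  set e₂ := Real.exp (-n * b ^ 2)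
  have h12 : 0 < e₁ - e₂ := by linarith
  refine ⟨(e₁ - eₛ) / (e₁ - e₂), div_pos (by linarith) h12, (div_lt_one h12).2 (by linarith), ?_⟩
  intro w Ω K Z ρ m₀ m₁ hw hK hc hρ hm hKρ hbd Y hY hYs
  set A := (m₁ - m₀) / (e₁ - e₂) with hA
  have hApos : 0 < A := div_pos (by linarith) h12
  have hAe : A * (e₁ - e₂) = m₁ - m₀ := div_mul_cancel₀ _ h12.ne'
  -- With `β = n / ρ²` the Gaussian takes the value `exp (-n a²)` at distance `a ρ`.
  have hscale : ∀ a : ℝ, -(n / ρ ^ 2) * (a * ρ) ^ 2 = -n * a ^ 2 := fun a => by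
    field_simp
  have hfar : ∀ (a : ℝ) (X : E), 0 < a → a * ρ ≤ ‖X - Z‖ →
      Real.exp (-(n / ρ ^ 2) * ‖X - Z‖ ^ 2) ≤ Real.exp (-n * a ^ 2) := by
    intro a X ha hX
    rw [← hscale a]
    apply Real.exp_le_exp.2
    have : (a * ρ) ^ 2 ≤ ‖X - Z‖ ^ 2 := by gcongr
    have h0 : 0 < n / ρ ^ 2 := by positivity
    nlinarith
  have key := hw.gaussian_le hK hc (A := A) (β := n / ρ ^ 2) (c := m₀ - A * e₂) (ρ := ρ) (Z := Z)
    hApos (by positivity) hρ (by field_simp; linarith) (by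
      intro X hX
      have hX1 : Real.exp (-(n / ρ ^ 2) * ‖X - Z‖ ^ 2) ≤ e₁ := by
        refine (hfar 1 X one_pos (by simpa using hKρ X hX)).trans_eq ?_
        rw [one_pow, mul_one]
      rcases hbd X hX with h1 | ⟨h1, h2⟩ | ⟨h1, h2⟩
      · left
        nlinarith
      · left
        have := hfar b X (by linarith) h2
        nlinarith
      · exact Or.inr ⟨h1, h2, hKρ X hX⟩) Y hY
  have hnear : eₛ ≤ Real.exp (-(n / ρ ^ 2) * ‖Y - Z‖ ^ 2) := by
    change Real.exp (-n * s ^ 2) ≤ _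
    rw [← hscale s]
    apply Real.exp_le_exp.2
    have : ‖Y - Z‖ ^ 2 ≤ (s * ρ) ^ 2 := by gcongr
    have h0 : 0 < n / ρ ^ 2 := by positivity
    nlinarith
  have hq : (e₁ - eₛ) / (e₁ - e₂) * (m₁ - m₀) = A * (e₁ - eₛ) := by
    rw [hA]
    ring
  rw [hq]
  nlinarith

end Viscosity

/-! ### Geometry of cylinders over a Lipschitz graph -/

section Geometry

open Topology Filter

variable {d : ℕ}

lemma norm_hpart_sub_le (Y Z : EuclideanSpace ℝ (Fin (d + 1))) :
    ‖hpart Y - hpart Z‖ ≤ ‖Y - Z‖ := by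
  rw [EuclideanSpace.norm_eq, EuclideanSpace.norm_eq]
  apply Real.sqrt_le_sqrt
  rw [Fin.sum_univ_castSucc (n := d)]
  simp only [hpart, PiLp.sub_apply]
  exact le_add_of_nonneg_right (by positivity)

lemma heightOver_le_add {g : EuclideanSpace ℝ (Fin d) → ℝ} {L : ℝ≥0} (hg : LipschitzWith L g)
    (Y Z : EuclideanSpace ℝ (Fin (d + 1))) :
    heightOver g Y ≤ heightOver g Z + (1 + L) * ‖Y - Z‖ := by
  have h1 : Y (Fin.last d) - Z (Fin.last d) ≤ ‖Y - Z‖ :=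
    (le_abs_self _).trans (by simpa using PiLp.norm_apply_le (Y - Z) (Fin.last d))
  have h2 : g (hpart Z) - g (hpart Y) ≤ L * ‖Y - Z‖ := by
    have h3 := hg.dist_le_mul (hpart Z) (hpart Y)
    rw [Real.dist_eq, dist_comm, dist_eq_norm] at h3
    calc _ ≤ |g (hpart Z) - g (hpart Y)| := le_abs_self _
      _ ≤ L * ‖hpart Y - hpart Z‖ := h3
      _ ≤ L * ‖Y - Z‖ := by gcongr; exact norm_hpart_sub_le Y Z
  unfold heightOver
  linarith

lemma continuous_hpart : Continuous (hpart (d := d)) := by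
  unfold hpart
  fun_prop

lemma continuous_heightOver {g : EuclideanSpace ℝ (Fin d) → ℝ} {L : ℝ≥0}
    (hg : LipschitzWith L g) : Continuous (heightOver g) := by
  have := hg.continuous.comp (continuous_hpart (d := d))
  unfold heightOver
  exact (by fun_prop : Continuous fun X : EuclideanSpace ℝ (Fin (d + 1)) => X (Fin.last d)).sub this

lemma isOpen_openGroundedCylinder {g : EuclideanSpace ℝ (Fin d) → ℝ} {L : ℝ≥0}
    (hg : LipschitzWith L g) (X : EuclideanSpace ℝ (Fin (d + 1))) (r : ℝ) :
    IsOpen (openGroundedCylinder g X r) :=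
  (isOpen_lt (continuous_const.sub continuous_hpart).norm continuous_const).inter
    ((isOpen_lt continuous_const (continuous_heightOver hg)).inter
      (isOpen_lt (continuous_heightOver hg) continuous_const))

lemma openGroundedCylinder_mono (g : EuclideanSpace ℝ (Fin d) → ℝ)
    (X : EuclideanSpace ℝ (Fin (d + 1))) {r r' : ℝ} (h : r ≤ r') :
    openGroundedCylinder g X r ⊆ openGroundedCylinder g X r' :=
  fun _ hY => ⟨hY.1.trans_le h, hY.2.1, hY.2.2.trans_le h⟩

lemma graphBase_mono (g : EuclideanSpace ℝ (Fin d) → ℝ)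
    (X : EuclideanSpace ℝ (Fin (d + 1))) {r r' : ℝ} (h : r ≤ r') :
    graphBase g X r ⊆ graphBase g X r' :=
  fun _ hY => ⟨hY.1.trans_le h, hY.2⟩

/-- The point `X` moved vertically by `a`. -/
noncomputable def vshift (X : EuclideanSpace ℝ (Fin (d + 1))) (a : ℝ) :
    EuclideanSpace ℝ (Fin (d + 1)) :=
  X + a • EuclideanSpace.single (Fin.last d) 1

lemma hpart_vshift (X : EuclideanSpace ℝ (Fin (d + 1))) (a : ℝ) :
    hpart (vshift X a) = hpart X := by
  ext i
  simp [hpart, vshift]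

lemma heightOver_vshift (g : EuclideanSpace ℝ (Fin d) → ℝ) (X : EuclideanSpace ℝ (Fin (d + 1)))
    (a : ℝ) : heightOver g (vshift X a) = heightOver g X + a := by
  unfold heightOver
  rw [hpart_vshift]
  simp [vshift]
  ring

lemma norm_sub_vshift (X : EuclideanSpace ℝ (Fin (d + 1))) (a : ℝ) :
    ‖X - vshift X a‖ = |a| := by
  simp [vshift, norm_smul]

end Geometry

/-! ### Improvement of one-sided bounds from a cylinder to a smaller one -/

section Iteration

open Topology Filter

variable {d : ℕ} {L : ℝ≥0} {g : EuclideanSpace ℝ (Fin d) → ℝ}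
  {Z : EuclideanSpace ℝ (Fin (d + 1))} {w : EuclideanSpace ℝ (Fin (d + 1)) → ℝ} {r q : ℝ}

/-- The lower bound on the upper part `δ r ≤ h` of a cylinder survives, with a loss independent of
`δ`, on the slightly larger upper part of the cylinder shrunk by the factor `1 - κ`,
`κ = 1 / (4 s²)`. The small shrinking makes a single annulus, centered above the given point and
contained in the cylinder, suffice. -/
lemma lower_bound_above (hg : LipschitzWith L g)
    (hq : IsDecayConstant (EuclideanSpace ℝ (Fin (d + 1))) (2 + L) (2 * (2 + L)) q)
    {κ δ m₀ m₁ : ℝ} (hκ : κ = 1 / (4 * (2 + (L : ℝ)) ^ 2)) (hδ : 0 < δ)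
    (hδ' : δ * (2 * (2 + L)) ≤ 1) (hr : 0 < r) (hm : m₀ < m₁)
    (hw : IsViscositySuperharmonicOn w (openGroundedCylinder g Z r))
    (hc : ContinuousOn w (openGroundedCylinder g Z r))
    (h₀ : ∀ Y ∈ openGroundedCylinder g Z r, m₀ ≤ w Y)
    (h₁ : ∀ Y ∈ openGroundedCylinder g Z r, δ * r ≤ heightOver g Y → m₁ ≤ w Y)
    {X : EuclideanSpace ℝ (Fin (d + 1))} (hX : ‖hpart Z - hpart X‖ < (1 - κ) * r)
    (hXl : (1 - κ) * δ * r ≤ heightOver g X) (hXu : heightOver g X < δ * r) :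
    m₁ - q * (m₁ - m₀) ≤ w X := by
  have hL : (0 : ℝ) ≤ L := L.coe_nonneg
  set s : ℝ := 2 + L with hs
  have hs2 : 2 ≤ s := by linarith
  have hκs : κ * (4 * s ^ 2) = 1 := by
    rw [hκ]
    field_simp
  have hκ0 : 0 < κ := by
    rw [hκ]
    positivity
  have hκs1 : κ * s ≤ 1 / 8 := by nlinarith
  set ρ := κ * (δ * r) with hρ
  have hδr : 0 < δ * r := by positivity
  have hρ0 : 0 < ρ := by positivity
  have hsρ : s * ρ ≤ 1 / 8 * (δ * r) := by
    calc s * ρ = (κ * s) * (δ * r) := by rw [hρ]; ring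
      _ ≤ _ := by gcongr
  have hssρ : 4 * s ^ 2 * ρ = δ * r := by
    calc 4 * s ^ 2 * ρ = κ * (4 * s ^ 2) * (δ * r) := by rw [hρ]; ring
      _ = _ := by rw [hκs, one_mul]
  have hδ4 : δ * r ≤ 1 / 4 * r := by
    have : δ * 4 ≤ 1 := by nlinarith
    nlinarith
  set P := vshift X (s * ρ) with hP
  have hXP : ‖X - P‖ = s * ρ := by rw [hP, norm_sub_vshift, abs_of_pos (by positivity)]
  have hPh : heightOver g P = heightOver g X + s * ρ := heightOver_vshift g X _
  set K : Set (EuclideanSpace ℝ (Fin (d + 1))) := Metric.closedBall P (2 * s * ρ) ∩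
    {Y | ρ ≤ ‖Y - P‖} with hK
  have hcl : IsClosed {Y : EuclideanSpace ℝ (Fin (d + 1)) | ρ ≤ ‖Y - P‖} :=
    isClosed_le continuous_const (by fun_prop)
  have hKc : IsCompact K := (isCompact_closedBall _ _).inter_right hcl
  have hlow : ∀ Y, heightOver g P ≤ heightOver g Y + (s - 1) * ‖Y - P‖ := fun Y => by
    have := heightOver_le_add hg P Y
    rw [norm_sub_rev] at this
    rw [hs]
    linarith
  have hKD : K ⊆ openGroundedCylinder g Z r := by
    intro Y hY
    have hYP : ‖Y - P‖ ≤ 2 * s * ρ := by simpa [dist_eq_norm] using hY.1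
    have hmul : (s - 1) * ‖Y - P‖ ≤ (s - 1) * (2 * s * ρ) := by
      have : 0 ≤ s - 1 := by linarith
      gcongr
    refine ⟨?_, ?_, ?_⟩
    · have h1 : ‖hpart Z - hpart Y‖ ≤ ‖hpart Z - hpart X‖ + ‖hpart X - hpart Y‖ := by
        simpa using norm_add_le (hpart Z - hpart X) (hpart X - hpart Y)
      have h2 : ‖hpart X - hpart Y‖ ≤ ‖Y - P‖ := by
        rw [norm_sub_rev, ← hpart_vshift X (s * ρ)]
        exact norm_hpart_sub_le _ _
      have h3 : 2 * s * ρ ≤ κ * r := by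
        calc 2 * s * ρ = κ * r * (δ * (2 * s)) := by rw [hρ]; ring
          _ ≤ κ * r * 1 := by gcongr
          _ = κ * r := mul_one _
      linarith
    · have := hlow Y
      nlinarith
    · have := heightOver_le_add hg Y P
      have h5 : (1 + (L : ℝ)) = s - 1 := by rw [hs]; ring
      rw [h5] at this
      nlinarith
  refine hq w _ K P ρ m₀ m₁ hw hKc (hc.mono hKD) hρ0 hm (fun Y hY => hY.2) ?_ X ?_ hXP.le
  · intro Y hY
    rcases lt_or_ge ρ ‖Y - P‖ with h1 | h1
    · rcases lt_or_ge ‖Y - P‖ (2 * s * ρ) with h2 | h2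
      · refine Or.inr (Or.inr ⟨hKD hY, ?_⟩)
        have ho : IsOpen {Y : EuclideanSpace ℝ (Fin (d + 1)) | ρ < ‖Y - P‖} :=
          isOpen_lt continuous_const (by fun_prop)
        filter_upwards [Metric.isOpen_ball.mem_nhds (show Y ∈ Metric.ball P (2 * s * ρ) by
          simpa [dist_eq_norm] using h2), ho.mem_nhds h1] with y hy1 hy2
        exact ⟨Metric.ball_subset_closedBall hy1, le_of_lt hy2⟩
      · exact Or.inr (Or.inl ⟨h₀ Y (hKD hY), h2⟩)
    · left
      refine h₁ Y (hKD hY) ?_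
      have := hlow Y
      have : (s - 1) * ‖Y - P‖ ≤ (s - 1) * ρ := by
        have : 0 ≤ s - 1 := by linarith
        gcongr
      nlinarith
  · refine ⟨?_, ?_⟩
    · rw [Metric.mem_closedBall, dist_eq_norm, hXP]
      nlinarith
    · change ρ ≤ ‖X - P‖
      rw [hXP]
      nlinarith

/-- If `w ≥ 0` on the graph and on `δ r ≤ h`, its negative part lives in a thin layer along the
graph. The region below the graph is fat at scale `δ r`, so the negative part shrinks by the factor
`q` each time the radius is decreased by a fixed multiple of `δ r`. -/
lemma lower_bound_layer (hg : LipschitzWith L g)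
    (hq : IsDecayConstant (EuclideanSpace ℝ (Fin (d + 1))) (2 + L) (2 * (2 + L)) q)
    (hq0 : 0 < q) {δ t : ℝ} (hδ : 0 < δ) (hδ1 : δ < 1) (hr : 0 < r) (ht : 0 < t)
    (hw : IsViscositySuperharmonicOn w (openGroundedCylinder g Z r))
    (hc : ContinuousOn w (openGroundedCylinder g Z r ∪ graphBase g Z r))
    (hb : ∀ Y ∈ graphBase g Z r, 0 ≤ w Y)
    (h₀ : ∀ Y ∈ openGroundedCylinder g Z r, -t ≤ w Y)
    (h₁ : ∀ Y ∈ openGroundedCylinder g Z r, δ * r ≤ heightOver g Y → 0 ≤ w Y) (j : ℕ) :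
    ∀ Y ∈ openGroundedCylinder g Z r,
      ‖hpart Z - hpart Y‖ < r - j * (2 * (2 + L) * (δ * r)) → -(q ^ j * t) ≤ w Y := by
  induction j with
  | zero =>
    intro Y hY _
    simpa using h₀ Y hY
  | succ j ih =>
    intro X hX hXr
    push_cast at hXr
    have hL : (0 : ℝ) ≤ L := L.coe_nonneg
    set s : ℝ := 2 + L with hs
    have hs2 : 2 ≤ s := by linarith
    set ρ := δ * r with hρ
    have hρ0 : 0 < ρ := by positivity
    have hρr : ρ < r := by nlinarith
    have hT : 0 < q ^ j * t := by positivity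
    rcases le_or_gt ρ (heightOver g X) with hXh | hXh
    · have h1 : 0 < q ^ (j + 1) * t := by positivity
      linarith [h₁ X hX hXh]
    set P := vshift X (-(s * ρ)) with hP
    have hXP : ‖X - P‖ = s * ρ := by rw [hP, norm_sub_vshift, abs_neg, abs_of_pos (by positivity)]
    have hPh : heightOver g P = heightOver g X - s * ρ := by
      rw [hP, heightOver_vshift]
      ring
    have hhc := continuous_heightOver hg
    have hpc := continuous_hpart (d := d)
    set K : Set (EuclideanSpace ℝ (Fin (d + 1))) := Metric.closedBall P (2 * s * ρ) ∩
      {Y | 0 ≤ heightOver g Y ∧ heightOver g Y ≤ ρ} with hK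
    have hcl : IsClosed {Y | 0 ≤ heightOver g Y ∧ heightOver g Y ≤ ρ} :=
      (isClosed_le continuous_const hhc).inter (isClosed_le hhc continuous_const)
    have hKc : IsCompact K := (isCompact_closedBall _ _).inter_right hcl
    have hKhor : ∀ Y ∈ K, ‖hpart Z - hpart Y‖ < r - j * (2 * s * ρ) := by
      intro Y hY
      have hYP : ‖Y - P‖ ≤ 2 * s * ρ := by simpa [dist_eq_norm] using hY.1
      have h1 : ‖hpart Z - hpart Y‖ ≤ ‖hpart Z - hpart X‖ + ‖hpart X - hpart Y‖ := by
        simpa using norm_add_le (hpart Z - hpart X) (hpart X - hpart Y)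
      have h2 : ‖hpart X - hpart Y‖ ≤ ‖Y - P‖ := by
        rw [norm_sub_rev, ← hpart_vshift X (-(s * ρ))]
        exact norm_hpart_sub_le _ _
      linarith
    have hKr : ∀ Y ∈ K, ‖hpart Z - hpart Y‖ < r := fun Y hY => by
      have : 0 ≤ j * (2 * s * ρ) := by positivity
      linarith [hKhor Y hY]
    have hKD : ∀ Y ∈ K, 0 < heightOver g Y → Y ∈ openGroundedCylinder g Z r := fun Y hY h =>
      ⟨hKr Y hY, h, hY.2.2.trans_lt hρr⟩
    have hKB : ∀ Y ∈ K, heightOver g Y = 0 → Y ∈ graphBase g Z r := fun Y hY h => ⟨hKr Y hY, h⟩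
    have hKU : K ⊆ openGroundedCylinder g Z r ∪ graphBase g Z r := fun Y hY =>
      hY.2.1.lt_or_eq.elim (fun h => Or.inl (hKD Y hY h)) fun h => Or.inr (hKB Y hY h.symm)
    have hgoal : (0 : ℝ) - q * (0 - -(q ^ j * t)) ≤ w X := by
      refine hq w _ K P ρ (-(q ^ j * t)) 0 hw hKc (hc.mono hKU) hρ0 (by linarith) ?_ ?_ X ?_ hXP.le
      · intro Y hY
        have h1 := heightOver_le_add hg Y P
        have h2 := hY.2.1
        have h3 : (1 + (L : ℝ)) = s - 1 := by rw [hs]; ring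
        rw [h3, hPh] at h1
        have h4 : (s - 1) * ρ ≤ (s - 1) * ‖Y - P‖ := by linarith
        exact le_of_mul_le_mul_left h4 (by linarith)
      · intro Y hY
        rcases hY.2.1.lt_or_eq with h0 | h0
        · rcases hY.2.2.lt_or_eq with h1 | h1
          · rcases lt_or_ge ‖Y - P‖ (2 * s * ρ) with h2 | h2
            · refine Or.inr (Or.inr ⟨hKD Y hY h0, ?_⟩)
              filter_upwards [Metric.isOpen_ball.mem_nhds (show Y ∈ Metric.ball P (2 * s * ρ) by
                simpa [dist_eq_norm] using h2), (isOpen_lt continuous_const hhc).mem_nhds h0,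
                (isOpen_lt hhc continuous_const).mem_nhds h1] with y hy1 hy2 hy3
              exact ⟨Metric.ball_subset_closedBall hy1, le_of_lt hy2, le_of_lt hy3⟩
            · exact Or.inr (Or.inl ⟨ih Y (hKD Y hY h0) (hKhor Y hY), h2⟩)
          · exact Or.inl (h₁ Y (hKD Y hY h0) h1.ge)
        · exact Or.inl (hb Y (hKB Y hY h0.symm))
      · refine ⟨?_, hX.2.1.le, hXh.le⟩
        rw [Metric.mem_closedBall, dist_eq_norm, hXP]
        nlinarith
    rw [pow_succ]
    linarith

lemma exists_pow_mul_le_lt {θ x r : ℝ} (hθ0 : 0 < θ) (hθ1 : θ < 1) (hx : 0 < x) (hxr : x < r) :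
    ∃ k : ℕ, θ ^ (k + 1) * r ≤ x ∧ x < θ ^ k * r := by
  have hr : 0 < r := hx.trans hxr
  obtain ⟨k, hk1, hk2⟩ :=
    exists_nat_pow_near_of_lt_one (div_pos hx hr) ((div_lt_one hr).2 hxr).le hθ0 hθ1
  rw [lt_div_iff₀ hr] at hk1
  rw [div_le_iff₀ hr] at hk2
  rcases hk2.lt_or_eq with h | h
  · exact ⟨k, hk1.le, h⟩
  · cases k with
    | zero =>
      rw [pow_zero, one_mul] at h
      exact absurd h hxr.ne
    | succ k =>
      refine ⟨k, h.ge, ?_⟩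
      have h1 : θ ^ (k + 1) * r = θ * (θ ^ k * r) := by ring
      rw [h, h1]
      exact mul_lt_of_lt_one_left (by positivity) hθ1

/-- Positivity near the boundary: a superharmonic function, nonnegative on the graph, that is
bounded below by `-t` in a cylinder and by a large multiple of `t` away from the graph is positive
on the axis of the cylinder. -/
theorem exists_pos_on_axis (d : ℕ) (L : ℝ≥0) :
    ∃ M δ : ℝ, 0 < M ∧ 0 < δ ∧ δ < 1 ∧
      ∀ (g : EuclideanSpace ℝ (Fin d) → ℝ), LipschitzWith L g →
      ∀ (Z : EuclideanSpace ℝ (Fin (d + 1))) (r t : ℝ), 0 < r → 0 < t →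
      ∀ w : EuclideanSpace ℝ (Fin (d + 1)) → ℝ,
        IsViscositySuperharmonicOn w (openGroundedCylinder g Z r) →
        ContinuousOn w (openGroundedCylinder g Z r ∪ graphBase g Z r) →
        (∀ Y ∈ graphBase g Z r, 0 ≤ w Y) →
        (∀ Y ∈ openGroundedCylinder g Z r, -t ≤ w Y) →
        (∀ Y ∈ openGroundedCylinder g Z r, δ * r ≤ heightOver g Y → M * t ≤ w Y) →
        ∀ X, hpart X = hpart Z → 0 < heightOver g X → heightOver g X < r → 0 < w X := by
  have hL : (0 : ℝ) ≤ L := L.coe_nonneg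
  set s : ℝ := 2 + L with hs
  have hs2 : 2 ≤ s := by linarith
  obtain ⟨q, hq0, hq1, hq⟩ := exists_isDecayConstant (E := EuclideanSpace ℝ (Fin (d + 1)))
    (show 1 < s by linarith) (show s < 2 * s by linarith)
  set κ : ℝ := 1 / (4 * s ^ 2) with hκ
  have hκ0 : 0 < κ := by positivity
  have hκ2 : κ < 1 / 2 := by
    rw [hκ, div_lt_div_iff₀ (by positivity) (by norm_num)]
    nlinarith
  -- The lower bound above loses the factor `a`; `δ` is then so small that the negative part gains
  -- the same factor in the layer.
  set a : ℝ := (1 - q) / 2 with ha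
  have ha0 : 0 < a := by linarith
  have ha1 : a < 1 := by linarith
  obtain ⟨N, hN⟩ := exists_pow_lt_of_lt_one ha0 hq1
  set δ : ℝ := κ / (2 * s * (N + 1)) with hδ
  have hδ0 : 0 < δ := by positivity
  have hδκ : δ * (2 * s) * (N + 1) = κ := by
    rw [hδ]
    field_simp
  have hδs : δ * (2 * s) ≤ κ := by
    have : 0 ≤ δ * (2 * s) * N := by positivity
    linarith
  have hδle : δ ≤ κ := by nlinarith
  have hMa : a * (1 / a) = 1 := mul_one_div_cancel ha0.ne'
  have hMa1 : 1 < 1 / a := by rwa [lt_div_iff₀ ha0, one_mul]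
  refine ⟨1 / a, δ, by positivity, hδ0, by linarith, ?_⟩
  intro g hg Z r t hr ht w hw hc hb h₀ h₁ X hXZ hX0 hXr
  set θ := 1 - κ with hθ
  have hθ0 : 0 < θ := by linarith
  have hθ1 : θ < 1 := by linarith
  have iter : ∀ k : ℕ, (∀ Y ∈ openGroundedCylinder g Z (θ ^ k * r), -(a ^ k * t) ≤ w Y) ∧
      (∀ Y ∈ openGroundedCylinder g Z (θ ^ k * r), δ * (θ ^ k * r) ≤ heightOver g Y →
        1 / a * (a ^ k * t) ≤ w Y) := by
    intro k
    induction k with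
    | zero => simpa only [pow_zero, one_mul] using ⟨h₀, h₁⟩
    | succ k ih =>
      obtain ⟨ih₀, ih₁⟩ := ih
      set r' := θ ^ k * r with hr'
      set t' := a ^ k * t with ht'
      have hr'0 : 0 < r' := by positivity
      have ht'0 : 0 < t' := by positivity
      have hrr : r' ≤ r := mul_le_of_le_one_left hr.le (pow_le_one₀ hθ0.le hθ1.le)
      have hr1 : θ ^ (k + 1) * r = θ * r' := by rw [hr', pow_succ]; ring
      have ht1 : a ^ (k + 1) * t = a * t' := by rw [ht', pow_succ]; ring
      have hsub : openGroundedCylinder g Z (θ * r') ⊆ openGroundedCylinder g Z r' :=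
        openGroundedCylinder_mono g Z (by nlinarith)
      have hw' := hw.mono (openGroundedCylinder_mono g Z hrr)
      have hc' : ContinuousOn w (openGroundedCylinder g Z r' ∪ graphBase g Z r') :=
        hc.mono (union_subset_union (openGroundedCylinder_mono g Z hrr) (graphBase_mono g Z hrr))
      have hMt : 0 < 1 / a * t' := by positivity
      rw [hr1, ht1]
      constructor
      · intro Y hY
        have h2 := lower_bound_layer hg hq hq0 hδ0 (by linarith) hr'0 ht'0 hw' hc'
          (fun y hy => hb y (graphBase_mono g Z hrr hy)) ih₀
          (fun y hy hyh => hMt.le.trans (ih₁ y hy hyh)) N Y (hsub hY) (hY.1.trans_le ?_)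
        · have h3 : q ^ N * t' ≤ a * t' := by gcongr
          linarith
        · have h3 : (N : ℝ) * (2 * s * (δ * r')) ≤ κ * r' := by
            rw [← hδκ]
            have : 0 ≤ δ * (2 * s) * r' := by positivity
            linarith
          rw [hθ]
          linarith
      · intro Y hY hYh
        have h3 : 1 / a * (a * t') = t' := by field_simp
        rw [h3]
        have h5 : t' ≤ 1 / a * t' := by nlinarith
        rcases lt_or_ge (heightOver g Y) (δ * r') with h4 | h4
        · have h2 := lower_bound_above hg hq hκ hδ0 (by linarith) hr'0
            (show -t' < 1 / a * t' by linarith) hw' (hc'.mono subset_union_left) ih₀ ih₁ hY.1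
            (by linarith) h4
          have h6 : 1 / a * t' - q * (1 / a * t' - -t') = t' + a * (1 / a) * t' * 1 - q * t' := by
            have : q = 1 - 2 * a := by rw [ha]; ring
            rw [this]
            field_simp
            ring
          rw [h6, hMa] at h2
          nlinarith
        · exact h5.trans (ih₁ Y (hsub hY) h4)
  -- The height of `X` lies in one of the intervals `[θᵏ⁺¹ r, θᵏ r)`, and `δ < θ`.
  obtain ⟨k, hk1, hk2⟩ := exists_pow_mul_le_lt hθ0 hθ1 hX0 hXr
  have hrk : 0 < θ ^ k * r := by positivity
  have hlow : δ * (θ ^ k * r) ≤ heightOver g X := by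
    refine le_trans ?_ hk1
    have h9 : θ ^ (k + 1) * r = θ * (θ ^ k * r) := by ring
    rw [h9]
    exact mul_le_mul_of_nonneg_right (by linarith) hrk.le
  have hXk : X ∈ openGroundedCylinder g Z (θ ^ k * r) := ⟨by simpa [hXZ] using hrk, hX0, hk2⟩
  have h7 := (iter k).2 X hXk hlow
  have h8 : 0 < 1 / a * (a ^ k * t) := by positivity
  linarith

end Iteration

/-! ### Singular solutions: comparison function and nondegeneracy -/

section Singular

open Laplacian Topology Filter

variable {d : ℕ} {L : ℝ≥0} {g : EuclideanSpace ℝ (Fin d) → ℝ} {γ lam r : ℝ}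
  {f u v : EuclideanSpace ℝ (Fin (d + 1)) → ℝ} {Z : EuclideanSpace ℝ (Fin (d + 1))}

lemma IsSingularSolution.contDiffAt (hg : LipschitzWith L g) (hu : IsSingularSolution g γ f Z r u)
    {Y : EuclideanSpace ℝ (Fin (d + 1))} (hY : Y ∈ openGroundedCylinder g Z r) :
    ContDiffAt ℝ 2 u Y :=
  hu.contDiffOn.contDiffAt ((isOpen_openGroundedCylinder hg Z r).mem_nhds hY)

/-- The function `K v - (u - v)⁺` is superharmonic: it is the minimum of `K v` and
`(K + 1) v - u`, and the latter is superharmonic where `v < u`, since there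
`f u ^ (-γ) ≤ f v ^ (-γ)`. -/
lemma IsSingularSolution.isViscositySuperharmonicOn (hg : LipschitzWith L g) (hγ : 0 < γ)
    (hf : ∀ Y ∈ openGroundedCylinder g Z r, 0 ≤ f Y) (hu : IsSingularSolution g γ f Z r u)
    (hv : IsSingularSolution g γ f Z r v) {K : ℝ} (hK : 0 ≤ K) :
    IsViscositySuperharmonicOn (fun Y => K * v Y - max (u Y - v Y) 0)
      (openGroundedCylinder g Z r) := by
  intro x hx φ hφ hmin
  have hux := hu.contDiffAt hg hx
  have hvx := hv.contDiffAt hg hx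
  have hv0 := hv.pos x hx
  have hfv : 0 ≤ f x * v x ^ (-γ) := mul_nonneg (hf x hx) (Real.rpow_nonneg hv0.le _)
  have hev := hv.equation x hx
  have heu := hu.equation x hx
  have hKv : ContDiffAt ℝ 2 (K • v) x := contDiffAt_const.smul hvx
  rcases le_or_gt (u x) (v x) with h | h
  · have hm : IsLocalMin (K • v - φ) x := by
      filter_upwards [hmin] with y hy
      simp only [Pi.sub_apply, Pi.smul_apply, smul_eq_mul] at hy ⊢
      rw [max_eq_right (by linarith)] at hy
      linarith [le_max_right (u y - v y) 0]
    have h1 := laplacian_le_of_isLocalMin_sub hKv hφ hm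
    rw [InnerProductSpace.laplacian_smul K hvx, smul_eq_mul] at h1
    nlinarith
  · have hD : ContDiffAt ℝ 2 (u - v) x := hux.sub hvx
    have hE : ContDiffAt ℝ 2 (K • v - (u - v)) x := hKv.sub hD
    have hm : IsLocalMin (K • v - (u - v) - φ) x := by
      filter_upwards [hmin] with y hy
      simp only [Pi.sub_apply, Pi.smul_apply, smul_eq_mul] at hy ⊢
      rw [max_eq_left (by linarith)] at hy
      linarith [le_max_left (u y - v y) 0]
    have h1 := laplacian_le_of_isLocalMin_sub hE hφ hm
    rw [hKv.laplacian_sub hD, hux.laplacian_sub hvx, InnerProductSpace.laplacian_smul K hvx,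
      smul_eq_mul] at h1
    have h2 : f x * u x ^ (-γ) ≤ f x * v x ^ (-γ) :=
      mul_le_mul_of_nonneg_left (Real.rpow_le_rpow_of_nonpos hv0 h.le (by linarith)) (hf x hx)
    nlinarith

/-- Nondegeneracy: the singular right-hand side makes a solution large at the center of any ball in
the cylinder. The bound `m` is the one for which the paraboloid of height `m` over the ball is a
strict subsolution. -/
lemma IsSingularSolution.le_center (hg : LipschitzWith L g) (hγ : 0 < γ) (hlam : 0 < lam)
    (hf : ∀ Y ∈ openGroundedCylinder g Z r, lam ≤ f Y) (hv : IsSingularSolution g γ f Z r v)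
    {X : EuclideanSpace ℝ (Fin (d + 1))} {ρ m : ℝ} (hρ : 0 < ρ) (hm : 0 < m)
    (hball : Metric.closedBall X ρ ⊆ openGroundedCylinder g Z r)
    (hmρ : m ^ (1 + γ) * (4 * (d + 1)) = lam * ρ ^ 2) : m ≤ v X := by
  set φ : EuclideanSpace ℝ (Fin (d + 1)) → ℝ := fun Y => m - m / ρ ^ 2 * ‖Y - X‖ ^ 2 with hφ
  have hφC : ContDiff ℝ 2 φ :=
    contDiff_const.sub (contDiff_const.mul ((contDiff_id.sub contDiff_const).norm_sq ℝ))
  have hcv : ContinuousOn v (Metric.closedBall X ρ) :=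
    hv.continuousOn.mono (hball.trans subset_union_left)
  have hXK : X ∈ Metric.closedBall X ρ := Metric.mem_closedBall_self hρ.le
  obtain ⟨Y, hYK, hY⟩ := (isCompact_closedBall X ρ).exists_isMinOn ⟨X, hXK⟩
    (hcv.sub hφC.continuous.continuousOn)
  have hYX : v Y - φ Y ≤ v X - φ X := hY hXK
  by_contra! hlt
  have hφX : φ X = m := by simp [hφ]
  have hvY : 0 < v Y := hv.pos Y (hball hYK)
  have hvφ : v Y < φ Y := by linarith
  have hφY : φ Y ≤ m := by
    have : 0 ≤ m / ρ ^ 2 * ‖Y - X‖ ^ 2 := by positivity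
    simp only [hφ]
    linarith
  have hYin : ‖Y - X‖ < ρ := by
    have h1 : ‖Y - X‖ ≤ ρ := by simpa [dist_eq_norm] using hYK
    refine lt_of_le_of_ne h1 fun h => ?_
    have h2 : φ Y = 0 := by
      simp only [hφ, h]
      field_simp
      ring
    linarith
  have hmin : IsLocalMin (v - φ) Y := hY.isLocalMin <|
    mem_of_superset (Metric.isOpen_ball.mem_nhds (by simpa [dist_eq_norm] using hYin))
      Metric.ball_subset_closedBall
  have h1 := laplacian_le_of_isLocalMin_sub (hv.contDiffAt hg (hball hYK)) hφC.contDiffAt hmin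
  rw [hφ, laplacian_paraboloid, finrank_euclideanSpace_fin] at h1
  push_cast at h1
  have h2 := hv.equation Y (hball hYK)
  have h3 : lam * m ^ (-γ) ≤ f Y * v Y ^ (-γ) := by
    have := Real.rpow_le_rpow_of_nonpos hvY (hvφ.le.trans hφY) (show -γ ≤ 0 by linarith)
    have h5 : 0 ≤ m ^ (-γ) := Real.rpow_nonneg hm.le _
    exact mul_le_mul (hf Y (hball hYK)) this h5 (hlam.le.trans (hf Y (hball hYK)))
  have h4 : lam * m ^ (-γ) ≤ 2 * (m / ρ ^ 2) * (d + 1) := by linarith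
  have h5 : m ^ (-γ) * m ^ γ = 1 := by
    rw [← Real.rpow_add hm]
    simp
  have h6 : m * m ^ γ = m ^ (1 + γ) := by rw [Real.rpow_add hm, Real.rpow_one]
  have h7 : lam * m ^ (-γ) * (m ^ γ * ρ ^ 2) ≤ 2 * (m / ρ ^ 2) * (d + 1) * (m ^ γ * ρ ^ 2) := by
    have : 0 < m ^ γ := Real.rpow_pos_of_pos hm _
    gcongr
  have h8 : lam * m ^ (-γ) * (m ^ γ * ρ ^ 2) = lam * ρ ^ 2 := by
    calc _ = lam * ρ ^ 2 * (m ^ (-γ) * m ^ γ) := by ring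
      _ = _ := by rw [h5, mul_one]
  have h9 : 2 * (m / ρ ^ 2) * (d + 1) * (m ^ γ * ρ ^ 2) = 2 * (d + 1) * m ^ (1 + γ) := by
    rw [← h6]
    field_simp
  rw [h8, h9] at h7
  have : 0 < lam * ρ ^ 2 := by positivity
  linarith

/-- The essential supremum over the closed cylinder bounds `u` at every point of the open one, by
continuity. -/
lemma IsSingularSolution.le_toReal_supNormOn (hg : LipschitzWith L g)
    (hu : IsSingularSolution g γ f Z r u) (hfin : supNormOn u (groundedCylinder g Z r) ≠ ∞)
    {Y : EuclideanSpace ℝ (Fin (d + 1))} (hY : Y ∈ openGroundedCylinder g Z r) :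
    u Y ≤ (supNormOn u (groundedCylinder g Z r)).toReal := by
  set U := supNormOn u (groundedCylinder g Z r) with hU
  have hop := isOpen_openGroundedCylinder hg Z r
  have hsub : openGroundedCylinder g Z r ⊆ groundedCylinder g Z r :=
    fun y hy => ⟨hy.1.le, hy.2.1.le, hy.2.2.le⟩
  have hae : ∀ᵐ y ∂volume.restrict (openGroundedCylinder g Z r), ‖u y‖ₑ ≤ U := by
    refine ae_restrict_of_ae_restrict_of_subset hsub ?_
    rw [hU, supNormOn, eLpNorm_exponent_top]
    exact ae_le_eLpNormEssSup
  by_contra! hlt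
  have hopen : IsOpen (openGroundedCylinder g Z r ∩ u ⁻¹' Ioi U.toReal) :=
    (hu.continuousOn.mono subset_union_left).isOpen_inter_preimage hop isOpen_Ioi
  have hpos : 0 < volume (openGroundedCylinder g Z r ∩ u ⁻¹' Ioi U.toReal) :=
    hopen.measure_pos volume ⟨Y, hY, hlt⟩
  rw [ae_restrict_iff' hop.measurableSet, ae_iff] at hae
  refine hpos.ne' (measure_mono_null (fun y hy => ?_) hae)
  simp only [mem_ofPred_eq, Classical.not_imp, not_le]
  refine ⟨hy.1, ?_⟩
  have h1 : U.toReal < u y := hy.2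
  rw [← ofReal_norm, Real.norm_of_nonneg (hu.pos y hy.1).le, ← ENNReal.ofReal_toReal hfin]
  exact (ENNReal.ofReal_lt_ofReal_iff (hu.pos y hy.1)).2 h1

end Singular

/-! ### The boundary Harnack principle -/

section Harnack

open Topology Filter

/-- One-sided form of the principle, with the norm of `u` replaced by a pointwise upper bound. -/
theorem exists_div_le (d : ℕ) (L : ℝ≥0) (γ lam : ℝ) (hγ : 0 < γ) (hlam : 0 < lam) :
    ∃ C : ℝ, 0 < C ∧ ∀ (R : ℝ), 0 < R →
      ∀ (g : EuclideanSpace ℝ (Fin d) → ℝ), LipschitzWith L g →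
      ∀ (f u v : EuclideanSpace ℝ (Fin (d + 1)) → ℝ),
        (∀ X ∈ openGroundedCylinder g 0 (3 * R), lam ≤ f X) →
        IsSingularSolution g γ f 0 (3 * R) u →
        IsSingularSolution g γ f 0 (3 * R) v →
        ∀ U : ℝ, (∀ X ∈ openGroundedCylinder g 0 (3 * R), u X ≤ U) →
        ∀ X ∈ groundedCylinder g 0 R \ graphSet g,
          u X / v X ≤ C * (U / R ^ (2 / (1 + γ))) := by
  have hL : (0 : ℝ) ≤ L := L.coe_nonneg
  obtain ⟨M, δ, hM, hδ0, hδ1, hax⟩ := exists_pos_on_axis d L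
  set c₁ : ℝ := δ / (2 * (1 + L)) with hc₁
  have hc₁0 : 0 < c₁ := by positivity
  have hc₁L : (1 + L) * c₁ = δ / 2 := by
    rw [hc₁]
    field_simp
  have hc₁h : c₁ < 1 / 2 := by nlinarith
  set c₀ : ℝ := (lam * c₁ ^ 2 / (4 * (d + 1))) ^ (1 / (1 + γ)) with hc₀
  have hc₀0 : 0 < c₀ := by positivity
  refine ⟨(M + 2) / c₀, by positivity, ?_⟩
  intro R hR g hg f u v hf hu hv U hU X ⟨⟨hX1, hX2, hX3⟩, hXΓ⟩
  have hX0 : 0 < heightOver g X := lt_of_le_of_ne hX2 fun h => hXΓ h.symm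
  set m : ℝ := c₀ * R ^ (2 / (1 + γ)) with hm
  have hRα : 0 < R ^ (2 / (1 + γ)) := Real.rpow_pos_of_pos hR _
  have hm0 : 0 < m := by positivity
  have hmpow : m ^ (1 + γ) * (4 * (d + 1)) = lam * (c₁ * R) ^ 2 := by
    have h1 : (1 + γ) ≠ 0 := by linarith
    rw [hm, Real.mul_rpow hc₀0.le hRα.le, hc₀, ← Real.rpow_mul (by positivity),
      ← Real.rpow_mul hR.le, one_div_mul_cancel h1, div_mul_cancel₀ _ h1, Real.rpow_one,
      Real.rpow_two]
    field_simp
  have htri : ∀ Y, ‖hpart X - hpart Y‖ < 3 / 2 * R →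
      ‖hpart (0 : EuclideanSpace ℝ (Fin (d + 1))) - hpart Y‖ < 5 / 2 * R := fun Y hY => by
    have := norm_add_le (hpart 0 - hpart X) (hpart X - hpart Y)
    rw [sub_add_sub_cancel] at this
    linarith
  have hsub : openGroundedCylinder g X (3 / 2 * R) ⊆ openGroundedCylinder g 0 (3 * R) :=
    fun Y hY => ⟨(htri Y hY.1).trans (by linarith), hY.2.1, hY.2.2.trans (by linarith)⟩
  have hsubB : graphBase g X (3 / 2 * R) ⊆ graphBase g 0 (3 * R) :=
    fun Y hY => ⟨(htri Y hY.1).trans (by linarith), hY.2⟩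
  have hball : ∀ Y ∈ openGroundedCylinder g X (3 / 2 * R), δ * (3 / 2 * R) ≤ heightOver g Y →
      Metric.closedBall Y (c₁ * R) ⊆ openGroundedCylinder g 0 (3 * R) := by
    intro Y hY hYh y hy
    rw [Metric.mem_closedBall, dist_eq_norm] at hy
    have h1 : (1 + L) * ‖y - Y‖ ≤ δ / 2 * R := by
      rw [← hc₁L, mul_assoc]
      gcongr
    have h2 : δ * R < R := mul_lt_of_lt_one_left hR hδ1
    have h3 : 0 < δ * R := by positivity
    have h4 : c₁ * R < 1 / 2 * R := mul_lt_mul_of_pos_right hc₁h hR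
    refine ⟨?_, ?_, ?_⟩
    · have h5 := norm_add_le (hpart 0 - hpart Y) (hpart Y - hpart y)
      rw [sub_add_sub_cancel] at h5
      have h6 := norm_hpart_sub_le Y y
      rw [norm_sub_rev Y y] at h6
      linarith [htri Y hY.1]
    · have := heightOver_le_add hg Y y
      rw [norm_sub_rev] at this
      linarith
    · have := heightOver_le_add hg y Y
      linarith [hY.2.2]
  have hint : ∀ {w : EuclideanSpace ℝ (Fin (d + 1)) → ℝ}, IsSingularSolution g γ f 0 (3 * R) w →
      ∀ Y ∈ openGroundedCylinder g X (3 / 2 * R), δ * (3 / 2 * R) ≤ heightOver g Y → m ≤ w Y :=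
    fun hw Y hY hYh => hw.le_center hg hγ hlam hf (by positivity) hm0 (hball Y hY hYh) hmpow
  have hR32 : 0 < 3 / 2 * R := by positivity
  -- The lower bound at an interior point gives `m ≤ U`, which absorbs additive constants.
  have hmU : m ≤ U := by
    set P := vshift X (δ * (3 / 2 * R) - heightOver g X) with hP
    have hPh : heightOver g P = δ * (3 / 2 * R) := by
      rw [hP, heightOver_vshift]
      ring
    have hPD : P ∈ openGroundedCylinder g X (3 / 2 * R) := by
      refine ⟨?_, ?_, ?_⟩
      · rw [hP, hpart_vshift]
        simpa using hR
      · rw [hPh]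
        positivity
      · rw [hPh]
        exact mul_lt_of_lt_one_left hR32 hδ1
    exact (hint hu P hPD hPh.ge).trans (hU P (hsub hPD))
  have hU0 : 0 < U := hm0.trans_le hmU
  set K : ℝ := (M + 1) * U / m with hK
  have hK0 : 0 < K := by positivity
  have hKm : K * m = (M + 1) * U := div_mul_cancel₀ _ hm0.ne'
  have hmax : ∀ Y ∈ openGroundedCylinder g 0 (3 * R), max (u Y - v Y) 0 ≤ U := fun Y hY =>
    max_le (by linarith [hU Y hY, hv.pos Y hY]) hU0.le
  have hsubU := union_subset_union hsub hsubB
  have hcu := hu.continuousOn.mono hsubU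
  have hcv := hv.continuousOn.mono hsubU
  have hcw : ContinuousOn (fun Y => K * v Y - max (u Y - v Y) 0)
      (openGroundedCylinder g X (3 / 2 * R) ∪ graphBase g X (3 / 2 * R)) := by fun_prop
  have hpos := hax g hg X (3 / 2 * R) U hR32 hU0 (fun Y => K * v Y - max (u Y - v Y) 0)
    ((IsSingularSolution.isViscositySuperharmonicOn hg hγ
      (fun Y hY => hlam.le.trans (hf Y hY)) hu hv hK0.le).mono hsub)
    hcw
    (fun Y hY => by simp [hu.zero_on_graph Y (hsubB hY), hv.zero_on_graph Y (hsubB hY)])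
    (fun Y hY => by
      have h1 := hmax Y (hsub hY)
      have h2 := mul_pos hK0 (hv.pos Y (hsub hY))
      linarith)
    (fun Y hY hYh => by
      have h1 := hmax Y (hsub hY)
      have h2 := mul_le_mul_of_nonneg_left (hint hv Y hY hYh) hK0.le
      linarith)
    X rfl hX0 (by linarith)
  have hvX : 0 < v X := hv.pos X ⟨by linarith, hX0, by linarith⟩
  have h1 : u X ≤ (K + 1) * v X := by linarith [le_max_left (u X - v X) 0]
  calc u X / v X ≤ K + 1 := (div_le_iff₀ hvX).2 h1
    _ ≤ K + U / m := by
      gcongr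
      exact (one_le_div hm0).2 hmU
    _ = (M + 2) / c₀ * (U / R ^ (2 / (1 + γ))) := by
      rw [hK, hm]
      field_simp
      ring

theorem theorem1p4 (d : ℕ) (L : ℝ≥0) (γ lam Lam : ℝ) (hγ : 0 < γ) (hlam : 0 < lam) :
    ∃ C : ℝ, 0 < C ∧
      ∀ (R : ℝ), 0 < R →
      ∀ (g : EuclideanSpace ℝ (Fin d) → ℝ), g 0 = 0 → LipschitzWith L g →
      ∀ (f u v : EuclideanSpace ℝ (Fin (d + 1)) → ℝ),
        (∀ X ∈ openGroundedCylinder g 0 (3 * R), lam ≤ f X ∧ f X ≤ Lam) →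
        IsSingularSolution g γ f 0 (3 * R) u →
        IsSingularSolution g γ f 0 (3 * R) v →
        ∀ X ∈ groundedCylinder g 0 R \ graphSet g,
          ENNReal.ofReal C⁻¹ *
              (ENNReal.ofReal (R ^ (2 / (1 + γ))) / supNormOn v (groundedCylinder g 0 (3 * R)))
            ≤ ENNReal.ofReal (u X / v X) ∧
          ENNReal.ofReal (u X / v X) ≤
            ENNReal.ofReal C *
              (supNormOn u (groundedCylinder g 0 (3 * R)) / ENNReal.ofReal (R ^ (2 / (1 + γ)))) := by
  obtain ⟨C, hC, hmain⟩ := exists_div_le d L γ lam hγ hlam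
  refine ⟨C, hC, ?_⟩
  intro R hR g _ hg f u v hf hu hv X hX
  have hRα : 0 < R ^ (2 / (1 + γ)) := Real.rpow_pos_of_pos hR _
  have upper : ∀ {u v : EuclideanSpace ℝ (Fin (d + 1)) → ℝ},
      IsSingularSolution g γ f 0 (3 * R) u → IsSingularSolution g γ f 0 (3 * R) v →
      ENNReal.ofReal (u X / v X) ≤ ENNReal.ofReal C *
        (supNormOn u (groundedCylinder g 0 (3 * R)) / ENNReal.ofReal (R ^ (2 / (1 + γ)))) := by
    intro u v hu hv
    by_cases hfin : supNormOn u (groundedCylinder g 0 (3 * R)) = ∞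
    · rw [hfin, ENNReal.top_div_of_ne_top ENNReal.ofReal_ne_top,
        ENNReal.mul_top (ENNReal.ofReal_pos.2 hC).ne']
      exact le_top
    · have h := hmain R hR g hg f u v (fun Y hY => (hf Y hY).1) hu hv _
        (fun Y hY => hu.le_toReal_supNormOn hg hfin hY) X hX
      refine (ENNReal.ofReal_le_ofReal h).trans_eq ?_
      rw [ENNReal.ofReal_mul hC.le, ENNReal.ofReal_div_of_pos hRα, ENNReal.ofReal_toReal hfin]
  refine ⟨?_, upper hu hv⟩
  have hXD : X ∈ openGroundedCylinder g 0 (3 * R) := by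
    obtain ⟨⟨hX1, hX2, hX3⟩, hXΓ⟩ := hX
    exact ⟨by linarith, lt_of_le_of_ne hX2 fun h => hXΓ h.symm, by linarith⟩
  have hdiv : 0 < v X / u X := div_pos (hv.pos X hXD) (hu.pos X hXD)
  -- The lower bound is the inverse of the upper bound for `v / u`.
  have h := ENNReal.inv_le_inv.2 (upper hv hu)
  rw [← ENNReal.ofReal_inv_of_pos hdiv, inv_div] at h
  refine le_trans (le_of_eq ?_) h
  rw [ENNReal.mul_inv (Or.inl (ENNReal.ofReal_pos.2 hC).ne') (Or.inl ENNReal.ofReal_ne_top),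
    ENNReal.inv_div (Or.inl ENNReal.ofReal_ne_top) (Or.inl (ENNReal.ofReal_pos.2 hRα).ne'),
    ENNReal.ofReal_inv_of_pos hC]

end Harnack
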